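/- Let $d\ge 1$, and let $p_1,p_2$ be the projections of $\mathbb{R}\times\mathbb{R}^d$ onto $\mathbb{R}$ and $\mathbb{R}^d$. Let $\Gamma\subset\mathbb{R}\times\mathbb{R}^d$ be a lattice in general position, that is, $p_1|_\Gamma$ is injective and $p_2(\Gamma)$ is dense in $\mathbb{R}^d$. For a bounded set $W\subset\mathbb{R}^d$ define the model set $$\Lambda(\Gamma,W)=\{p_1(\gamma):\gamma\in\Gamma,\ p_2(\gamma)\in W\}\subset\mathbb{R}.$$ Two sets $\Lambda,\Lambda'\subset\mathbb{R}$ are bounded distance equivalent if there are a constant $K>0$ and a bijection $\chi:\Lambda\to\Lambda'$ with $|\chi(\lambda)-\lambda|\le K$ for all $\lambda\in\Lambda$. A set in $\mathbb{R}^d$ is Riemann measurable if its boundary has Lebesgue measure zero. A polytope is a finite union of (closed, nondegenerate) $d$-dimensional simplices with pairwise disjoint interiors. Let $W,W'\subset\mathbb{R}^d$ be two bounded Riemann measurable sets (resp. two polytopes). If $\Lambda(\Gamma,W)$ and $\Lambda(\Gamma,W')$ are bounded distance equivalent, then $W,W'$ are equidecomposable up to measure zero with bounded Riemann measurable pieces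 (resp. with polytope pieces), using translations from $p_2(\Gamma)$. That is, there exist finitely many bounded Riemann measurable sets (resp. polytopes) $A_1,\dots,A_n\subset\mathbb{R}^d$, vectors $g_1,\dots,g_n\in p_2(\Gamma)$ and a set $X\subset\mathbb{R}^d$ whose complement has Lebesgue measure zero, such that the sets $A_j\cap X$ are pairwise disjoint with union $W\cap X$, and the sets $(A_j+g_j)\cap X$ are pairwise disjoint with union $W'\cap X$. -/

import Mathlib

open MeasureTheory Set

/-- A lattice `Γ ⊂ ℝ × ℝ^d` is in general position if the first projection is injective on `Γ`
and the second projection of `Γ` is dense in `ℝ^d`. -/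
def InGeneralPosition {d : ℕ} (Γ : Submodule ℤ (ℝ × EuclideanSpace ℝ (Fin d))) : Prop :=
  InjOn Prod.fst (Γ : Set (ℝ × EuclideanSpace ℝ (Fin d))) ∧
    Dense (Prod.snd '' (Γ : Set (ℝ × EuclideanSpace ℝ (Fin d))))

/-- The model set `Λ(Γ, W) = {p₁(γ) : γ ∈ Γ, p₂(γ) ∈ W}` in `ℝ`. -/
def modelSet {d : ℕ} (Γ : Submodule ℤ (ℝ × EuclideanSpace ℝ (Fin d)))
    (W : Set (EuclideanSpace ℝ (Fin d))) : Set ℝ :=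
  {t | ∃ γ ∈ Γ, γ.2 ∈ W ∧ γ.1 = t}

/-- The projection `p₂(Γ)`, a group of translations of `ℝ^d`. -/
def sndProj {d : ℕ} (Γ : Submodule ℤ (ℝ × EuclideanSpace ℝ (Fin d))) :
    AddSubgroup (EuclideanSpace ℝ (Fin d)) :=
  Γ.toAddSubgroup.map (AddMonoidHom.snd ℝ (EuclideanSpace ℝ (Fin d)))

/-- Two point sets are bounded distance equivalent if some bijection between them moves every
point by at most a constant `K > 0`. -/
def BoundedDistanceEquivalent {E : Type*} [PseudoMetricSpace E] (Λ Λ' : Set E) : Prop :=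
  ∃ K : ℝ, 0 < K ∧ ∃ χ : Λ ≃ Λ', ∀ x : Λ, dist (χ x : E) (x : E) ≤ K

/-- A set is Riemann measurable if its boundary is a Lebesgue null set. -/
def IsRiemannMeasurable {d : ℕ} (S : Set (EuclideanSpace ℝ (Fin d))) : Prop :=
  volume (frontier S) = 0

/-- A polytope in `ℝ^d` is a finite union of (closed, nondegenerate) `d`-dimensional simplices
with pairwise disjoint interiors. It may be non-convex or disconnected. -/
def IsPolytope {d : ℕ} (S : Set (EuclideanSpace ℝ (Fin d))) : Prop :=
  ∃ (n : ℕ) (σ : Fin n → Affine.Simplex ℝ (EuclideanSpace ℝ (Fin d)) d),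
    Pairwise (fun i j => Disjoint (interior (convexHull ℝ (range (σ i).points)))
      (interior (convexHull ℝ (range (σ j).points)))) ∧
    S = ⋃ i, convexHull ℝ (range (σ i).points)

/-- `A` and `B` are equidecomposable up to measure zero, using translations by vectors of `G`,
with pieces having the property `P`: there are finitely many sets `S j`, vectors `g j ∈ G` and a
set `X` of full Lebesgue measure such that the sets `S j ∩ X` partition `A ∩ X`, and the sets
`(S j + g j) ∩ X` partition `B ∩ X`. -/
def EquidecomposableUpToNull {d : ℕ} (G : AddSubgroup (EuclideanSpace ℝ (Fin d)))
    (P : Set (EuclideanSpace ℝ (Fin d)) → Prop) (A B : Set (EuclideanSpace ℝ (Fin d))) : Prop :=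
  ∃ (n : ℕ) (S : Fin n → Set (EuclideanSpace ℝ (Fin d)))
    (g : Fin n → EuclideanSpace ℝ (Fin d)) (X : Set (EuclideanSpace ℝ (Fin d))),
    (∀ j, P (S j)) ∧ (∀ j, g j ∈ G) ∧ volume Xᶜ = 0 ∧
    Pairwise (fun i j => Disjoint (S i ∩ X) (S j ∩ X)) ∧
    (⋃ j, S j ∩ X) = A ∩ X ∧
    Pairwise (fun i j => Disjoint (((fun x => x + g i) '' S i) ∩ X)
      (((fun x => x + g j) '' S j) ∩ X)) ∧
    (⋃ j, ((fun x => x + g j) '' S j) ∩ X) = B ∩ X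

/-!
The proof turns bounded distance equivalence into a bounded cocycle, and reads a partner rule for
the points of `W` and `W'` off the places where that cocycle is maximal.

For `x ∈ ℝ^d` let the pattern at `x` be the model set of the window `W - x`, and let `disc x t` be
the number of its points in `[0, t)` minus the same number for `W'`, with signs when `t < 0`. Moving
`x` along `p₂(Γ)` shifts the patterns (`disc_add`). Bounded distance equivalence bounds the
increments of `disc 0`, hence those of `disc x` for every `x` in the orbit of `0`, and by density
and local constancy for every generic `x`, that is, one whose orbit avoids the boundaries of `W` and
`W'` (`exists_disc_sub_le`). Increments are integers, so they attain a largest value `M`, and they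
attain it between two fixed times on a whole open set `U` (`exists_max_disc`). Every orbit returns
to `U` in every time window of some fixed length (`exists_return_time`). Hence, as in the
Gottschalk–Hedlund theorem, `disc x` has, at every generic `x`, a maximum over all times, it is
attained with bounded gaps, and finding it takes only a bounded window of times.

Between two times of maximal discrepancy the two patterns have equally many points. Matching points
of equal rank, counted from such a time, does not depend on the time chosen, commutes with the
shifts and moves points by a bounded amount. The points `y ∈ W` whose partner is `y + p₂(v)` form a
piece, one for each `v` in a finite subset of `Γ`; membership in a piece is decided by the
membership in `W` and `W'` of finitely many translates (`equidecomposable_finitelyDetermined`).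

Such a piece has a null boundary when `W` and `W'` do. When they are polytopes it agrees off a null
set with a polytope: finitely many barycentric coordinates decide membership, and a simplex can be
subdivided into simplices on which each of these has constant sign, by repeatedly cutting an edge
where it crosses a hyperplane (`tileable_hasConstantSign`).
-/

/-! ### Counting points of locally finite subsets of the line -/

/-- The signed number of points of `A` between `0` and `t`: the points of `[0, t)` count
positively, those of `[t, 0)` negatively. It is meaningful for locally finite `A`. -/
noncomputable def signedCount (A : Set ℝ) (t : ℝ) : ℤ :=
  (A ∩ Ico 0 t).ncard - (A ∩ Ico t 0).ncard

lemma ncard_inter_Ico_add {A : Set ℝ} (hA : ∀ s t, (A ∩ Ico s t).Finite) {s u t : ℝ}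
    (hsu : s ≤ u) (hut : u ≤ t) :
    (A ∩ Ico s t).ncard = (A ∩ Ico s u).ncard + (A ∩ Ico u t).ncard := by
  rw [← Ico_union_Ico_eq_Ico hsu hut, inter_union_distrib_left,
    ncard_union_eq _ (hA _ _) (hA _ _)]
  refine disjoint_left.2 fun x hx hx' => ?_
  exact absurd hx.2.2 (not_lt.2 hx'.2.1)

lemma signedCount_zero (A : Set ℝ) : signedCount A 0 = 0 := by simp [signedCount]

lemma signedCount_sub {A : Set ℝ} (hA : ∀ s t, (A ∩ Ico s t).Finite) {s t : ℝ} (hst : s ≤ t) :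
    signedCount A t - signedCount A s = (A ∩ Ico s t).ncard := by
  have nil : ∀ {u v : ℝ}, v ≤ u → (A ∩ Ico u v).ncard = 0 := fun h => by simp [Ico_eq_empty_of_le h]
  unfold signedCount
  rcases le_total 0 s with h0 | h0
  · rw [nil h0, nil (h0.trans hst), ncard_inter_Ico_add hA h0 hst]
    push_cast; ring
  · rcases le_total 0 t with h1 | h1
    · rw [nil h0, nil h1, ncard_inter_Ico_add hA h0 h1]
      push_cast; ring
    · rw [nil h0, nil h1, ncard_inter_Ico_add hA hst h1]
      push_cast; ring

lemma signedCount_mono {A : Set ℝ} (hA : ∀ s t, (A ∩ Ico s t).Finite) :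
    Monotone (signedCount A) := fun s t hst => by
  have := signedCount_sub hA hst
  omega

lemma signedCount_lt {A : Set ℝ} (hA : ∀ s t, (A ∩ Ico s t).Finite) {a t : ℝ} (ha : a ∈ A)
    (hat : a < t) : signedCount A a < signedCount A t := by
  have h1 := signedCount_sub hA hat.le
  have h2 : 0 < (A ∩ Ico a t).ncard :=
    (ncard_pos (hA _ _)).2 ⟨a, ha, le_rfl, hat⟩
  omega

lemma signedCount_injOn {A : Set ℝ} (hA : ∀ s t, (A ∩ Ico s t).Finite) :
    InjOn (signedCount A) A := by
  intro a ha b hb hab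
  by_contra hne
  rcases lt_or_gt_of_ne hne with h | h
  · exact (signedCount_lt hA ha h).ne hab
  · exact (signedCount_lt hA hb h).ne hab.symm

lemma exists_signedCount_eq {A : Set ℝ} (hA : ∀ s t, (A ∩ Ico s t).Finite) {b₁ b₂ : ℝ} {k : ℤ}
    (h₁ : signedCount A b₁ ≤ k) (h₂ : k < signedCount A b₂) :
    ∃ a ∈ A, a ∈ Ico b₁ b₂ ∧ signedCount A a = k := by
  have hb : b₁ ≤ b₂ := by
    by_contra h
    have := signedCount_mono hA (not_le.1 h).le
    omega
  have hfin := hA b₁ b₂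
  have hsub := signedCount_sub hA hb
  -- An injective map between finite sets of equal size is onto.
  have himg : hfin.toFinset.image (signedCount A)
      = Finset.Ico (signedCount A b₁) (signedCount A b₂) := by
    apply Finset.eq_of_subset_of_card_le
    · intro m hm
      obtain ⟨a, ha, rfl⟩ := Finset.mem_image.1 hm
      rw [Finite.mem_toFinset] at ha
      exact Finset.mem_Ico.2 ⟨signedCount_mono hA ha.2.1, signedCount_lt hA ha.1 ha.2.2⟩
    · rw [Finset.card_image_of_injOn, Int.card_Ico, ← ncard_eq_toFinset_card _ hfin, hsub]
      · simp
      · intro a ha b hb'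
        simp only [Finite.coe_toFinset] at ha hb'
        exact signedCount_injOn hA ha.1 hb'.1
  have hk : k ∈ hfin.toFinset.image (signedCount A) := by
    rw [himg]; exact Finset.mem_Ico.2 ⟨h₁, h₂⟩
  obtain ⟨a, ha, rfl⟩ := Finset.mem_image.1 hk
  rw [Finite.mem_toFinset] at ha
  exact ⟨a, ha.1, ha.2, rfl⟩

lemma signedCount_preimage_add_right {A : Set ℝ} (hA : ∀ s t, (A ∩ Ico s t).Finite) (δ t : ℝ) :
    signedCount ((· + δ) ⁻¹' A) t = signedCount A (t + δ) - signedCount A δ := by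
  have key : ∀ u v : ℝ, (((· + δ) ⁻¹' A) ∩ Ico u v).ncard = (A ∩ Ico (u + δ) (v + δ)).ncard := by
    intro u v
    rw [← ncard_image_of_injective _ (add_left_injective δ), image_preimage_inter,
      image_add_const_Ico]
  unfold signedCount
  rw [key, key, zero_add]
  change _ = signedCount A (t + δ) - signedCount A δ
  rcases le_total 0 t with h | h
  · rw [signedCount_sub hA (by linarith), Ico_eq_empty_of_le (show δ ≤ t + δ by linarith)]
    simp
  · have h1 := signedCount_sub hA (show t + δ ≤ δ by linarith)
    rw [Ico_eq_empty_of_le (show t + δ ≤ δ by linarith)]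
    simp only [inter_empty, ncard_empty]
    omega

lemma signedCount_congr {A B : Set ℝ} {τ t : ℝ} (h : A ∩ Icc (-τ) τ = B ∩ Icc (-τ) τ)
    (ht : |t| ≤ τ) : signedCount A t = signedCount B t := by
  have key : ∀ u v : ℝ, -τ ≤ u → v ≤ τ → A ∩ Ico u v = B ∩ Ico u v := by
    intro u v hu hv
    have hs : Ico u v = Icc (-τ) τ ∩ Ico u v :=
      (inter_eq_right.2 (Ico_subset_Icc_self.trans (Icc_subset_Icc hu hv))).symm
    rw [hs, ← inter_assoc, h, inter_assoc]
  have h1 := abs_le.1 ht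
  unfold signedCount
  rw [key 0 t (by linarith) h1.2, key t 0 h1.1 (by linarith)]

/-- One half of the comparison of counts: a map moving points by at most `K` can only push points
of `[s, t)` into the two collars of width `K`. -/
lemma ncard_inter_Ico_le_of_equiv {A B : Set ℝ} (hB : ∀ s t, (B ∩ Ico s t).Finite) {K : ℝ}
    (hK : 0 < K) (χ : A ≃ B) (hχ : ∀ x : A, dist (χ x : ℝ) (x : ℝ) ≤ K) {C : ℕ}
    (hC : ∀ s, (B ∩ Ico s (s + 2 * K)).ncard ≤ C) {s t : ℝ} (hst : s ≤ t) :
    (A ∩ Ico s t).ncard ≤ (B ∩ Ico s t).ncard + 2 * C := by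
  classical
  have h1 : (A ∩ Ico s t).ncard ≤ (B ∩ Ico (s - 2 * K) (t + 2 * K)).ncard := by
    refine ncard_le_ncard_of_injOn (fun a => if h : a ∈ A then (χ ⟨a, h⟩ : ℝ) else 0) ?_ ?_ (hB _ _)
    · intro a ha
      have := abs_le.1 (hχ ⟨a, ha.1⟩)
      simp only [ha.1, dif_pos]
      refine ⟨(χ ⟨a, ha.1⟩).2, ?_, ?_⟩
      · linarith [ha.2.1, this.1]
      · linarith [ha.2.2, this.2]
    · intro a ha b hb hab
      simp only [dif_pos ha.1, dif_pos hb.1] at hab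
      exact congrArg Subtype.val (χ.injective (Subtype.ext hab))
  have h2 := ncard_inter_Ico_add hB (s := s - 2 * K) (u := s) (t := t + 2 * K)
    (by linarith) (by linarith)
  have h3 := ncard_inter_Ico_add hB (s := s) (u := t) (t := t + 2 * K) hst (by linarith)
  have h4 := hC (s - 2 * K)
  rw [sub_add_cancel] at h4
  have h5 := hC t
  omega

lemma exists_signedCount_discrepancy_le {A B : Set ℝ} (hA : ∀ s t, (A ∩ Ico s t).Finite)
    (hB : ∀ s t, (B ∩ Ico s t).Finite)
    (hA' : ∀ L, ∃ C : ℕ, ∀ s, (A ∩ Ico s (s + L)).ncard ≤ C)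
    (hB' : ∀ L, ∃ C : ℕ, ∀ s, (B ∩ Ico s (s + L)).ncard ≤ C)
    (h : BoundedDistanceEquivalent A B) :
    ∃ C : ℤ, ∀ s t,
      (signedCount A t - signedCount B t) - (signedCount A s - signedCount B s) ≤ C := by
  obtain ⟨K, hK, χ, hχ⟩ := h
  obtain ⟨C₁, hC₁⟩ := hA' (2 * K)
  obtain ⟨C₂, hC₂⟩ := hB' (2 * K)
  refine ⟨2 * C₁ + 2 * C₂, fun s t => ?_⟩
  have hχ' : ∀ x : B, dist (χ.symm x : ℝ) (x : ℝ) ≤ K := fun x => by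
    have := hχ (χ.symm x)
    rwa [Equiv.apply_symm_apply, dist_comm] at this
  rcases le_total s t with hst | hst
  · have h1 := ncard_inter_Ico_le_of_equiv hB hK χ hχ hC₂ hst
    have h2 := signedCount_sub hA hst
    have h3 := signedCount_sub hB hst
    omega
  · have h1 := ncard_inter_Ico_le_of_equiv hA hK χ.symm hχ' hC₁ hst
    have h2 := signedCount_sub hA hst
    have h3 := signedCount_sub hB hst
    omega

/-! ### Recurrence for lattices in general position -/

section Lattice

variable {d : ℕ} {Γ : Submodule ℤ (ℝ × EuclideanSpace ℝ (Fin d))}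

lemma finite_lattice_norm_le [DiscreteTopology Γ] (r : ℝ) :
    {γ : ℝ × EuclideanSpace ℝ (Fin d) | γ ∈ Γ ∧ ‖γ‖ ≤ r}.Finite := by
  have hcl : IsClosed (Γ : Set (ℝ × EuclideanSpace ℝ (Fin d))) :=
    AddSubgroup.isClosed_of_discrete (H := Γ.toAddSubgroup)
  have hd : IsDiscrete (Γ : Set (ℝ × EuclideanSpace ℝ (Fin d))) := ⟨‹DiscreteTopology Γ›⟩
  refine (Metric.finite_isBounded_inter_isClosed hd
    (Metric.isBounded_closedBall (x := (0 : ℝ × EuclideanSpace ℝ (Fin d))) (r := r)) hcl).subset ?_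
  rintro γ ⟨h1, h2⟩
  exact ⟨by simpa using h2, h1⟩

lemma countable_lattice [DiscreteTopology Γ] :
    (Γ : Set (ℝ × EuclideanSpace ℝ (Fin d))).Countable := by
  refine (countable_iUnion fun n : ℕ => (finite_lattice_norm_le (Γ := Γ) n).countable).mono ?_
  intro γ hγ
  obtain ⟨n, hn⟩ := exists_nat_ge ‖γ‖
  exact mem_iUnion.2 ⟨n, hγ, hn⟩

lemma exists_lattice_norm_sub_le [DiscreteTopology Γ] [IsZLattice ℝ Γ] :
    ∃ R : ℝ, ∀ z, ∃ γ ∈ Γ, ‖z - γ‖ ≤ R := by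
  have : Module.Finite ℤ Γ := ZLattice.module_finite ℝ Γ
  have : Module.Free ℤ Γ := ZLattice.module_free ℝ Γ
  let b := (Module.Free.chooseBasis ℤ Γ).ofZLatticeBasis ℝ Γ
  have hb : Submodule.span ℤ (range b) = Γ :=
    (Module.Free.chooseBasis ℤ Γ).ofZLatticeBasis_span ℝ Γ
  refine ⟨∑ i, ‖b i‖, fun z => ⟨ZSpan.floor b z, ?_, ZSpan.norm_fract_le b z⟩⟩
  exact hb.le (ZSpan.floor b z).2

lemma exists_lattice_add_mem (hd : Dense (Prod.snd '' (Γ : Set (ℝ × EuclideanSpace ℝ (Fin d)))))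
    {U : Set (EuclideanSpace ℝ (Fin d))} (hU : IsOpen U) (hne : U.Nonempty)
    (y : EuclideanSpace ℝ (Fin d)) : ∃ γ ∈ Γ, y + γ.2 ∈ U := by
  obtain ⟨u, hu⟩ := hne
  obtain ⟨_, hg, γ, hγ, rfl⟩ := hd.inter_open_nonempty ((y + ·) ⁻¹' U)
    (hU.preimage (continuous_const.add continuous_id)) ⟨u - y, by simpa using hu⟩
  exact ⟨γ, hγ, hg⟩

lemma exists_finset_lattice_add_mem
    (hd : Dense (Prod.snd '' (Γ : Set (ℝ × EuclideanSpace ℝ (Fin d)))))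
    {U : Set (EuclideanSpace ℝ (Fin d))} (hU : IsOpen U) (hne : U.Nonempty) (r : ℝ) :
    ∃ I : Finset (ℝ × EuclideanSpace ℝ (Fin d)), (∀ γ ∈ I, γ ∈ Γ) ∧
      ∀ y, ‖y‖ ≤ r → ∃ γ ∈ I, y + γ.2 ∈ U := by
  classical
  obtain ⟨I, hI⟩ := (isCompact_closedBall (0 : EuclideanSpace ℝ (Fin d)) r).elim_finite_subcover
    (fun γ : Γ => (· + γ.1.2) ⁻¹' U)
    (fun γ => hU.preimage (continuous_id.add continuous_const)) (fun y _ => by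
      obtain ⟨γ, hγ, h⟩ := exists_lattice_add_mem hd hU hne y
      exact mem_iUnion.2 ⟨⟨γ, hγ⟩, h⟩)
  refine ⟨I.image Subtype.val, fun γ hγ => ?_, fun y hy => ?_⟩
  · obtain ⟨γ, -, rfl⟩ := Finset.mem_image.1 hγ
    exact γ.2
  · obtain ⟨γ, hγ, h⟩ := mem_iUnion₂.1 (hI (show y ∈ _ by simpa using hy))
    exact ⟨γ, Finset.mem_image_of_mem _ hγ, h⟩

/-- Every orbit of the translation action visits the open set `U` in every time window of some
fixed length `L`. -/
lemma exists_return_time [DiscreteTopology Γ] [IsZLattice ℝ Γ]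
    (hd : Dense (Prod.snd '' (Γ : Set (ℝ × EuclideanSpace ℝ (Fin d)))))
    {U : Set (EuclideanSpace ℝ (Fin d))} (hU : IsOpen U) (hne : U.Nonempty) :
    ∃ L : ℝ, ∀ y T, ∃ γ ∈ Γ, T ≤ γ.1 ∧ γ.1 ≤ T + L ∧ y + γ.2 ∈ U := by
  obtain ⟨R, hR⟩ := exists_lattice_norm_sub_le (Γ := Γ)
  obtain ⟨I, hIΓ, hI⟩ := exists_finset_lattice_add_mem hd hU hne R
  obtain ⟨Q, hQ⟩ : ∃ Q : ℝ, ∀ γ ∈ I, |γ.1| ≤ Q := by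
    obtain ⟨Q, hQ⟩ := (I.finite_toSet.image (fun γ => |γ.1|)).bddAbove
    exact ⟨Q, fun γ hγ => hQ ⟨γ, hγ, rfl⟩⟩
  refine ⟨2 * (R + Q), fun y T => ?_⟩
  obtain ⟨γ, hγ, h⟩ := hR (T + R + Q, -y)
  have h1 : |T + R + Q - γ.1| ≤ R := (norm_fst_le ((T + R + Q, -y) - γ)).trans h
  have h2 : ‖y + γ.2‖ ≤ R := by
    have := (norm_snd_le ((T + R + Q, -y) - γ)).trans h
    rw [← norm_neg]
    simpa [sub_eq_add_neg, add_comm] using this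
  obtain ⟨β, hβ, hβU⟩ := hI _ h2
  have h3 := abs_le.1 (hQ β hβ)
  have h4 := abs_le.1 h1
  refine ⟨γ + β, Γ.add_mem hγ (hIΓ β hβ), ?_, ?_, ?_⟩
  · simp only [Prod.fst_add]; linarith
  · simp only [Prod.fst_add]; linarith
  · simpa [add_assoc] using hβU

end Lattice

/-! ### Patterns and their discrepancy -/

section Pattern

variable {d : ℕ} {Γ : Submodule ℤ (ℝ × EuclideanSpace ℝ (Fin d))}
  {W W' : Set (EuclideanSpace ℝ (Fin d))} {x y : EuclideanSpace ℝ (Fin d)}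

/-- The model set with window `W - x`. -/
def pattern (Γ : Submodule ℤ (ℝ × EuclideanSpace ℝ (Fin d)))
    (W : Set (EuclideanSpace ℝ (Fin d))) (x : EuclideanSpace ℝ (Fin d)) : Set ℝ :=
  modelSet Γ ((x + ·) ⁻¹' W)

lemma fst_mem_pattern (hinj : InjOn Prod.fst (Γ : Set (ℝ × EuclideanSpace ℝ (Fin d))))
    {γ : ℝ × EuclideanSpace ℝ (Fin d)} (hγ : γ ∈ Γ) :
    γ.1 ∈ pattern Γ W x ↔ x + γ.2 ∈ W := by
  constructor
  · rintro ⟨β, hβ, h, h'⟩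
    rwa [← hinj hβ hγ h']
  · exact fun h => ⟨γ, hγ, h, rfl⟩

lemma pattern_zero : pattern Γ W 0 = modelSet Γ W := by
  simp [pattern]

lemma pattern_add {δ : ℝ × EuclideanSpace ℝ (Fin d)} (hδ : δ ∈ Γ) :
    pattern Γ W (x + δ.2) = (· + δ.1) ⁻¹' pattern Γ W x := by
  ext t
  constructor
  · rintro ⟨γ, hγ, h, rfl⟩
    refine ⟨γ + δ, Γ.add_mem hγ hδ, ?_, rfl⟩
    simp only [mem_preimage, Prod.snd_add] at h ⊢
    convert h using 1
    abel
  · rintro ⟨γ, hγ, h, h'⟩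
    refine ⟨γ - δ, Γ.sub_mem hγ hδ, ?_, ?_⟩
    · simp only [mem_preimage, Prod.snd_sub] at h ⊢
      convert h using 1
      abel
    · simp only [Prod.fst_sub, h', add_sub_cancel_right]

/-- On bounded windows of times, and for `x` in a bounded set, the pattern at `x` depends only on
the membership in `W` of finitely many translates of `x`. -/
lemma exists_finset_pattern_congr [DiscreteTopology Γ] (ρ r τ : ℝ) :
    ∃ F : Finset (ℝ × EuclideanSpace ℝ (Fin d)), (∀ γ ∈ F, γ ∈ Γ) ∧
      ∀ W : Set (EuclideanSpace ℝ (Fin d)), (∀ w ∈ W, ‖w‖ ≤ ρ) → ∀ x y, ‖x‖ ≤ r → ‖y‖ ≤ r →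
        (∀ γ ∈ F, (x + γ.2 ∈ W ↔ y + γ.2 ∈ W)) →
          pattern Γ W x ∩ Icc (-τ) τ = pattern Γ W y ∩ Icc (-τ) τ := by
  have hfin := finite_lattice_norm_le (Γ := Γ) (max τ (ρ + r))
  refine ⟨hfin.toFinset, fun γ hγ => ((Finite.mem_toFinset _).1 hγ).1, fun W hW => ?_⟩
  have key : ∀ x y, ‖x‖ ≤ r → (∀ γ ∈ hfin.toFinset, (x + γ.2 ∈ W ↔ y + γ.2 ∈ W)) →
      pattern Γ W x ∩ Icc (-τ) τ ⊆ pattern Γ W y ∩ Icc (-τ) τ := by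
    rintro x y hx h _ ⟨⟨γ, hγ, hγW, rfl⟩, ht⟩
    have hmem : γ ∈ hfin.toFinset := by
      refine (Finite.mem_toFinset _).2 ⟨hγ, norm_prod_le_iff.2 ⟨?_, ?_⟩⟩
      · exact (abs_le.2 ht).trans (le_max_left _ _)
      · refine le_trans ?_ (le_max_right _ _)
        have := norm_sub_le (x + γ.2) x
        rw [add_sub_cancel_left] at this
        have := hW _ hγW
        linarith
    exact ⟨⟨γ, hγ, (h γ hmem).1 hγW, rfl⟩, ht⟩
  exact fun x y hx hy h => (key x y hx h).antisymm (key y x hy fun γ hγ => (h γ hγ).symm)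

lemma exists_ncard_pattern_le [DiscreteTopology Γ] (hW : Bornology.IsBounded W) (L : ℝ) :
    ∃ C : ℕ, ∀ x s, (pattern Γ W x ∩ Ico s (s + L)).Finite ∧
      (pattern Γ W x ∩ Ico s (s + L)).ncard ≤ C := by
  obtain ⟨ρ, hρ⟩ := hW.exists_norm_le
  -- Differences of two points of the set lie in this finite set of times.
  have hfin := (finite_lattice_norm_le (Γ := Γ) (max L (ρ + ρ))).image Prod.fst
  refine ⟨(Prod.fst '' {γ | γ ∈ Γ ∧ ‖γ‖ ≤ max L (ρ + ρ)}).ncard, fun x s => ?_⟩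
  rcases (pattern Γ W x ∩ Ico s (s + L)).eq_empty_or_nonempty with h | ⟨_, ⟨γ, hγ, hγW, rfl⟩, ht⟩
  · rw [h]; simp
  · have hmaps : MapsTo (· - γ.1) (pattern Γ W x ∩ Ico s (s + L))
        (Prod.fst '' {γ | γ ∈ Γ ∧ ‖γ‖ ≤ max L (ρ + ρ)}) := by
      rintro _ ⟨⟨β, hβ, hβW, rfl⟩, hs⟩
      refine ⟨β - γ, ⟨Γ.sub_mem hβ hγ, norm_prod_le_iff.2 ⟨?_, ?_⟩⟩, rfl⟩
      · refine le_trans (abs_le.2 ⟨?_, ?_⟩) (le_max_left _ _)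
        · simp only [Prod.fst_sub]; linarith [ht.2, hs.1]
        · simp only [Prod.fst_sub]; linarith [ht.1, hs.2]
      · refine le_trans ?_ (le_max_right _ _)
        have h1 := norm_sub_le (x + β.2) (x + γ.2)
        rw [add_sub_add_left_eq_sub] at h1
        exact h1.trans (add_le_add (hρ _ hβW) (hρ _ hγW))
    have hinj : InjOn (· - γ.1) (pattern Γ W x ∩ Ico s (s + L)) := sub_left_injective.injOn
    exact ⟨hfin.of_injOn hmaps hinj, ncard_le_ncard_of_injOn _ hmaps hinj hfin⟩

lemma finite_pattern_inter_Ico [DiscreteTopology Γ] (hW : Bornology.IsBounded W) (x) (s t : ℝ) :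
    (pattern Γ W x ∩ Ico s t).Finite := by
  obtain ⟨C, hC⟩ := exists_ncard_pattern_le (Γ := Γ) hW (t - s)
  simpa using (hC x s).1

/-- The discrepancy of the patterns of `W` and `W'` at `x`: the signed number of points of the
first between `0` and `t`, minus that of the second. -/
noncomputable def disc (Γ : Submodule ℤ (ℝ × EuclideanSpace ℝ (Fin d)))
    (W W' : Set (EuclideanSpace ℝ (Fin d))) (x : EuclideanSpace ℝ (Fin d)) (t : ℝ) : ℤ :=
  signedCount (pattern Γ W x) t - signedCount (pattern Γ W' x) t

lemma signedCount_pattern_add [DiscreteTopology Γ] (hW : Bornology.IsBounded W)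
    {δ : ℝ × EuclideanSpace ℝ (Fin d)} (hδ : δ ∈ Γ) (t : ℝ) :
    signedCount (pattern Γ W (x + δ.2)) t =
      signedCount (pattern Γ W x) (t + δ.1) - signedCount (pattern Γ W x) δ.1 := by
  rw [pattern_add hδ, signedCount_preimage_add_right (finite_pattern_inter_Ico hW x)]

/-- The cocycle identity of the discrepancy. -/
lemma disc_add [DiscreteTopology Γ] (hW : Bornology.IsBounded W) (hW' : Bornology.IsBounded W')
    {δ : ℝ × EuclideanSpace ℝ (Fin d)} (hδ : δ ∈ Γ) (t : ℝ) :
    disc Γ W W' (x + δ.2) t = disc Γ W W' x (t + δ.1) - disc Γ W W' x δ.1 := by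
  simp only [disc, signedCount_pattern_add hW hδ, signedCount_pattern_add hW' hδ]
  ring

/-- The points whose `p₂(Γ)`-orbit avoids the boundaries of `W` and `W'`. -/
def genericSet (Γ : Submodule ℤ (ℝ × EuclideanSpace ℝ (Fin d)))
    (W W' : Set (EuclideanSpace ℝ (Fin d))) : Set (EuclideanSpace ℝ (Fin d)) :=
  {x | ∀ γ ∈ Γ, x + γ.2 ∉ frontier W ∧ x + γ.2 ∉ frontier W'}

lemma add_mem_genericSet {δ : ℝ × EuclideanSpace ℝ (Fin d)} (hδ : δ ∈ Γ)
    (hx : x ∈ genericSet Γ W W') : x + δ.2 ∈ genericSet Γ W W' := fun γ hγ => by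
  have := hx (δ + γ) (Γ.add_mem hδ hγ)
  simpa [add_assoc] using this

lemma volume_compl_genericSet [DiscreteTopology Γ] (hW : volume (frontier W) = 0)
    (hW' : volume (frontier W') = 0) : volume (genericSet Γ W W')ᶜ = 0 := by
  have : (genericSet Γ W W')ᶜ ⊆
      ⋃ γ ∈ (Γ : Set (ℝ × EuclideanSpace ℝ (Fin d))), (· + γ.2) ⁻¹' (frontier W ∪ frontier W') := by
    intro x hx
    simp only [genericSet, mem_compl_iff, mem_ofPred_eq, not_forall] at hx
    obtain ⟨γ, hγ, h⟩ := hx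
    refine mem_iUnion₂.2 ⟨γ, hγ, ?_⟩
    simp only [mem_preimage, mem_union]
    tauto
  refine measure_mono_null this ((measure_biUnion_null_iff countable_lattice).2 fun γ _ => ?_)
  rw [measure_preimage_add_right]
  exact measure_union_null hW hW'

lemma eventually_mem_iff_of_notMem_frontier {X : Type*} [TopologicalSpace X] {S : Set X} {x : X}
    (hx : x ∉ frontier S) : ∀ᶠ y in nhds x, (y ∈ S ↔ x ∈ S) := by
  rw [frontier, mem_sdiff, not_and_not_right] at hx
  by_cases h : x ∈ closure S
  · filter_upwards [mem_interior_iff_mem_nhds.1 (hx h)] with y hy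
    exact iff_of_true hy (interior_subset (hx h))
  · filter_upwards [isClosed_closure.isOpen_compl.mem_nhds h] with y hy
    exact iff_of_false (fun hy' => hy (subset_closure hy')) (fun hx' => h (subset_closure hx'))

lemma eventually_disc_eq [DiscreteTopology Γ] (hW : Bornology.IsBounded W)
    (hW' : Bornology.IsBounded W') (hx : x ∈ genericSet Γ W W') (t : ℝ) :
    ∀ᶠ y in nhds x, disc Γ W W' y t = disc Γ W W' x t := by
  obtain ⟨ρ, hρ⟩ := (hW.union hW').exists_norm_le
  obtain ⟨F, hFΓ, hF⟩ := exists_finset_pattern_congr (Γ := Γ) ρ (‖x‖ + 1) |t|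
  have h1 : ∀ᶠ y in nhds x, ‖y‖ ≤ ‖x‖ + 1 :=
    (continuous_norm.continuousAt.eventually_lt continuousAt_const (by simp)).mono
      fun _ h => h.le
  have h2 : ∀ᶠ y in nhds x, ∀ γ ∈ F, (y + γ.2 ∈ W ↔ x + γ.2 ∈ W) ∧
      (y + γ.2 ∈ W' ↔ x + γ.2 ∈ W') := by
    refine (Filter.eventually_all_finset F).2 fun γ hγ => ?_
    have hc : ContinuousAt (· + γ.2) x := by fun_prop
    exact (hc.eventually (eventually_mem_iff_of_notMem_frontier (hx γ (hFΓ γ hγ)).1)).and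
      (hc.eventually (eventually_mem_iff_of_notMem_frontier (hx γ (hFΓ γ hγ)).2))
  filter_upwards [h1, h2] with y hy1 hy2
  have e1 := hF W (fun w hw => hρ w (Or.inl hw)) y x hy1 (by linarith) fun γ hγ => (hy2 γ hγ).1
  have e2 := hF W' (fun w hw => hρ w (Or.inr hw)) y x hy1 (by linarith) fun γ hγ => (hy2 γ hγ).2
  rw [disc, disc, signedCount_congr e1 le_rfl, signedCount_congr e2 le_rfl]

/-- The discrepancy bound holds along the orbit of `0` by the bounded distance equivalence; as the
discrepancy is locally constant at generic points and the orbit is dense, it holds at all of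
these. -/
lemma exists_disc_sub_le [DiscreteTopology Γ] (hΓ : InGeneralPosition Γ)
    (hW : Bornology.IsBounded W) (hW' : Bornology.IsBounded W')
    (hbd : BoundedDistanceEquivalent (modelSet Γ W) (modelSet Γ W')) :
    ∃ C : ℤ, ∀ x ∈ genericSet Γ W W', ∀ s t, disc Γ W W' x t - disc Γ W W' x s ≤ C := by
  rw [← pattern_zero, ← pattern_zero (W := W')] at hbd
  obtain ⟨C, hC⟩ := exists_signedCount_discrepancy_le (finite_pattern_inter_Ico hW 0)
    (finite_pattern_inter_Ico hW' 0)
    (fun L => (exists_ncard_pattern_le (Γ := Γ) hW L).imp fun _ h s => (h 0 s).2)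
    (fun L => (exists_ncard_pattern_le (Γ := Γ) hW' L).imp fun _ h s => (h 0 s).2) hbd
  refine ⟨C, fun x hx s t => ?_⟩
  have hev := (eventually_disc_eq hW hW' hx s).and (eventually_disc_eq hW hW' hx t)
  obtain ⟨_, ⟨γ, hγ, rfl⟩, hs, ht⟩ :=
    ((mem_closure_iff_frequently.1 (hΓ.2 x)).and_eventually hev).exists
  rw [← hs, ← ht, ← zero_add γ.2, disc_add hW hW' hγ, disc_add hW hW' hγ]
  have := hC (s + γ.1) (t + γ.1)
  unfold disc
  omega

/-- The increments of the discrepancy at generic points have a largest value, and it is attained,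
between two fixed times, on a nonempty open set. -/
lemma exists_max_disc [DiscreteTopology Γ] (hΓ : InGeneralPosition Γ)
    (hW : Bornology.IsBounded W) (hW' : Bornology.IsBounded W')
    (hfW : volume (frontier W) = 0) (hfW' : volume (frontier W') = 0)
    (hbd : BoundedDistanceEquivalent (modelSet Γ W) (modelSet Γ W')) :
    ∃ M : ℤ, (∀ x ∈ genericSet Γ W W', ∀ s t, disc Γ W W' x t - disc Γ W W' x s ≤ M) ∧
      ∃ U : Set (EuclideanSpace ℝ (Fin d)), IsOpen U ∧ U.Nonempty ∧ ∃ s t,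
        ∀ x ∈ U, disc Γ W W' x t - disc Γ W W' x s = M := by
  obtain ⟨C, hC⟩ := exists_disc_sub_le hΓ hW hW' hbd
  have hne : (genericSet Γ W W').Nonempty := by
    by_contra h
    have := volume_compl_genericSet (Γ := Γ) hfW hfW'
    rw [not_nonempty_iff_eq_empty.1 h, compl_empty] at this
    exact isOpen_univ.measure_ne_zero volume univ_nonempty this
  obtain ⟨x₀, hx₀⟩ := hne
  obtain ⟨M, ⟨x, hx, s, t, hM⟩, hmax⟩ := Int.exists_greatest_of_bdd
    (P := fun m => ∃ x ∈ genericSet Γ W W', ∃ s t, disc Γ W W' x t - disc Γ W W' x s = m)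
    ⟨C, by rintro _ ⟨x, hx, s, t, rfl⟩; exact hC x hx s t⟩ ⟨_, x₀, hx₀, 0, 0, rfl⟩
  refine ⟨M, fun x hx s t => hmax _ ⟨x, hx, s, t, rfl⟩, ?_⟩
  obtain ⟨U, hU, hUo, hxU⟩ := eventually_nhds_iff.1
    ((eventually_disc_eq hW hW' hx s).and (eventually_disc_eq hW hW' hx t))
  refine ⟨U, hUo, ⟨x, hxU⟩, s, t, fun y hy => ?_⟩
  rw [(hU y hy).1, (hU y hy).2, hM]

end Pattern

/-! ### Decomposition by partners -/

section Decomposition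

variable {d : ℕ} {Γ : Submodule ℤ (ℝ × EuclideanSpace ℝ (Fin d))}
  {W W' : Set (EuclideanSpace ℝ (Fin d))} {x y : EuclideanSpace ℝ (Fin d)}

lemma mem_image_add_right_iff {S : Set (EuclideanSpace ℝ (Fin d))} :
    x ∈ (fun x => x + y) '' S ↔ x - y ∈ S :=
  ⟨by rintro ⟨z, hz, rfl⟩; simpa using hz, fun h => ⟨_, h, sub_add_cancel _ _⟩⟩

lemma equidecomposableUpToNull_of_finite {G : AddSubgroup (EuclideanSpace ℝ (Fin d))}
    {P : Set (EuclideanSpace ℝ (Fin d)) → Prop} {ι : Type*} [Finite ι]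
    (S : ι → Set (EuclideanSpace ℝ (Fin d))) (g : ι → EuclideanSpace ℝ (Fin d))
    (X : Set (EuclideanSpace ℝ (Fin d))) (hP : ∀ j, P (S j)) (hg : ∀ j, g j ∈ G)
    (hX : volume Xᶜ = 0)
    (hd : ∀ x ∈ X, ∀ i j, x ∈ S i → x ∈ S j → i = j)
    (hu : ∀ x ∈ X, (∃ j, x ∈ S j) ↔ x ∈ W)
    (hd' : ∀ x ∈ X, ∀ i j, x - g i ∈ S i → x - g j ∈ S j → i = j)
    (hu' : ∀ x ∈ X, (∃ j, x - g j ∈ S j) ↔ x ∈ W') :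
    EquidecomposableUpToNull G P W W' := by
  obtain ⟨n, ⟨e⟩⟩ := Finite.exists_equiv_fin ι
  refine ⟨n, fun i => S (e.symm i), fun i => g (e.symm i), X, fun j => hP _, fun j => hg _, hX,
    fun i j hij => disjoint_left.2 ?_, ?_, fun i j hij => disjoint_left.2 ?_, ?_⟩
  · rintro x ⟨h1, h2⟩ ⟨h3, -⟩
    exact hij (e.symm.injective (hd x h2 _ _ h1 h3))
  · ext x
    simp only [mem_iUnion, mem_inter_iff, exists_and_right, and_congr_left_iff]
    exact fun hx => (e.symm.surjective.exists (p := fun i => x ∈ S i)).symm.trans (hu x hx)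
  · rintro x ⟨h1, h2⟩ ⟨h3, -⟩
    rw [mem_image_add_right_iff] at h1 h3
    exact hij (e.symm.injective (hd' x h2 _ _ h1 h3))
  · ext x
    simp only [mem_iUnion, mem_inter_iff, exists_and_right, and_congr_left_iff,
      mem_image_add_right_iff]
    exact fun hx => (e.symm.surjective.exists (p := fun i => x - g i ∈ S i)).symm.trans (hu' x hx)

/-- Membership in `S` is decided, among the points of `W`, by the membership in `W` and in `W'` of
finitely many translates. This is a finitary form of lying in the Boolean algebra generated by
translates of `W` and `W'`. -/
def FinitelyDetermined (W W' S : Set (EuclideanSpace ℝ (Fin d))) : Prop :=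
  S ⊆ W ∧ ∃ T : Finset (EuclideanSpace ℝ (Fin d)), ∀ x ∈ W, ∀ y ∈ W,
    (∀ t ∈ T, (x + t ∈ W ↔ y + t ∈ W) ∧ (x + t ∈ W' ↔ y + t ∈ W')) → x ∈ S → y ∈ S

/-- The points `y ∈ W` whose partner in `W'` is `y + p₂(v)`. The maximum of the discrepancy at `y`
is read off at the end time `b.2` of a pair `b ∈ B` over which the discrepancy grows by `M`; the
partner of the point at time `0` is the point of the pattern of `W'` of equal rank, when both
patterns are counted from a time of maximal discrepancy. -/
def partnerPiece (Γ : Submodule ℤ (ℝ × EuclideanSpace ℝ (Fin d)))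
    (W W' : Set (EuclideanSpace ℝ (Fin d))) (M : ℤ) (B : Finset (ℝ × ℝ))
    (v : ℝ × EuclideanSpace ℝ (Fin d)) : Set (EuclideanSpace ℝ (Fin d)) :=
  {y | y ∈ W ∧ y + v.2 ∈ W' ∧ ∃ b ∈ B, disc Γ W W' y b.2 - disc Γ W W' y b.1 = M ∧
    signedCount (pattern Γ W' y) v.1 + disc Γ W W' y b.2 = 0}

lemma finitelyDetermined_partnerPiece [DiscreteTopology Γ] (hW : Bornology.IsBounded W)
    (hW' : Bornology.IsBounded W') (M : ℤ) (B : Finset (ℝ × ℝ))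
    (v : ℝ × EuclideanSpace ℝ (Fin d)) :
    FinitelyDetermined W W' (partnerPiece Γ W W' M B v) := by
  classical
  refine ⟨fun y hy => hy.1, ?_⟩
  obtain ⟨ρ, hρ⟩ := (hW.union hW').exists_norm_le
  obtain ⟨τ, hτ⟩ : ∃ τ : ℝ, |v.1| ≤ τ ∧ ∀ b ∈ B, |b.1| ≤ τ ∧ |b.2| ≤ τ := by
    obtain ⟨Q, hQ⟩ := (B.finite_toSet.image (fun b => max |b.1| |b.2|)).bddAbove
    exact ⟨max |v.1| Q, le_max_left _ _, fun b hb => max_le_iff.1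
      ((hQ ⟨b, hb, rfl⟩).trans (le_max_right _ _))⟩
  obtain ⟨F, -, hF⟩ := exists_finset_pattern_congr (Γ := Γ) ρ ρ τ
  refine ⟨insert v.2 (F.image Prod.snd), fun x hx y hy h => ?_⟩
  have h' : ∀ γ ∈ F, _ := fun γ hγ =>
    h γ.2 (Finset.mem_insert_of_mem (Finset.mem_image_of_mem _ hγ))
  have e1 := hF W (fun w hw => hρ w (Or.inl hw)) x y (hρ x (Or.inl hx)) (hρ y (Or.inl hy))
    fun γ hγ => (h' γ hγ).1
  have e2 := hF W' (fun w hw => hρ w (Or.inr hw)) x y (hρ x (Or.inl hx)) (hρ y (Or.inl hy))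
    fun γ hγ => (h' γ hγ).2
  have e3 : ∀ t, |t| ≤ τ → disc Γ W W' x t = disc Γ W W' y t := fun t ht => by
    rw [disc, disc, signedCount_congr e1 ht, signedCount_congr e2 ht]
  rintro ⟨-, h2, b, hb, h3, h4⟩
  have hb' := hτ.2 b hb
  refine ⟨hy, ((h _ (Finset.mem_insert_self _ _)).2).1 h2, b, hb, ?_, ?_⟩
  · rw [← e3 _ hb'.1, ← e3 _ hb'.2, h3]
  · rw [← e3 _ hb'.2, ← signedCount_congr e2 hτ.1, h4]

/-- The discrepancy has the same value at the end of any two increments of maximal size. -/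
lemma disc_eq_of_max {M : ℤ} (hM : ∀ s t, disc Γ W W' x t - disc Γ W W' x s ≤ M)
    {s t s' t' : ℝ} (h : disc Γ W W' x t - disc Γ W W' x s = M)
    (h' : disc Γ W W' x t' - disc Γ W W' x s' = M) : disc Γ W W' x t = disc Γ W W' x t' := by
  have h1 := hM s t'
  have h2 := hM s' t
  omega

/-- The pieces are the sets `partnerPiece` for `v` in a finite subset of `Γ`. They are disjoint,
and so are their translates, because ranks separate the points of a pattern; they cover because
between two times of maximal discrepancy every rank that occurs in one pattern occurs in the
other. -/
theorem equidecomposable_finitelyDetermined [DiscreteTopology Γ] [IsZLattice ℝ Γ]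
    (hΓ : InGeneralPosition Γ) (hW : Bornology.IsBounded W) (hW' : Bornology.IsBounded W')
    (hfW : volume (frontier W) = 0) (hfW' : volume (frontier W') = 0)
    (hbd : BoundedDistanceEquivalent (modelSet Γ W) (modelSet Γ W')) :
    EquidecomposableUpToNull (sndProj Γ) (FinitelyDetermined W W') W W' := by
  classical
  obtain ⟨M, hM, U, hUo, hUne, s₀, t₀, hU⟩ := exists_max_disc hΓ hW hW' hfW hfW' hbd
  obtain ⟨ρ, hρ⟩ := (hW.union hW').exists_norm_le
  obtain ⟨I, hIΓ, hI⟩ := exists_finset_lattice_add_mem hΓ.2 hUo hUne ρ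
  obtain ⟨L, hL⟩ := exists_return_time (Γ := Γ) hΓ.2 hUo hUne
  have hA := fun x => finite_pattern_inter_Ico (Γ := Γ) hW x
  have hA' := fun x => finite_pattern_inter_Ico (Γ := Γ) hW' x
  -- A visit of `y` to `U` at `γ` gives an increment of size `M`.
  have hvisit : ∀ y, ∀ γ ∈ Γ, y + γ.2 ∈ U →
      disc Γ W W' y (t₀ + γ.1) - disc Γ W W' y (s₀ + γ.1) = M := by
    intro y γ hγ h
    have := hU _ h
    rw [disc_add hW hW' hγ, disc_add hW hW' hγ] at this
    omega
  let B : Finset (ℝ × ℝ) := I.image fun γ => (s₀ + γ.1, t₀ + γ.1)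
  have hB : ∀ y, ‖y‖ ≤ ρ → ∃ b ∈ B, disc Γ W W' y b.2 - disc Γ W W' y b.1 = M := by
    intro y hy
    obtain ⟨γ, hγ, h⟩ := hI y hy
    exact ⟨_, Finset.mem_image_of_mem _ hγ, hvisit y γ (hIΓ γ hγ) h⟩
  -- Around time `0` there are times of maximal discrepancy on both sides, at distance at most `L`.
  have hpeaks : ∀ y, ∃ s₁ t₁ s₂ t₂, disc Γ W W' y t₁ - disc Γ W W' y s₁ = M ∧
      disc Γ W W' y t₂ - disc Γ W W' y s₂ = M ∧ -L ≤ t₁ ∧ t₁ ≤ 0 ∧ 0 < t₂ ∧ t₂ ≤ L + 1 := by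
    intro y
    obtain ⟨γ₁, hγ₁, h1, h2, h3⟩ := hL y (-t₀ - L)
    obtain ⟨γ₂, hγ₂, h4, h5, h6⟩ := hL y (-t₀ + 1)
    exact ⟨_, _, _, _, hvisit y γ₁ hγ₁ h3, hvisit y γ₂ hγ₂ h6, by linarith, by linarith,
      by linarith, by linarith⟩
  have hfin := finite_lattice_norm_le (Γ := Γ) (max (L + 1) (ρ + ρ))
  have hmemF : ∀ γ ∈ Γ, ∀ y, ‖y‖ ≤ ρ → ‖y + γ.2‖ ≤ ρ → |γ.1| ≤ L + 1 →
      γ ∈ Γ ∧ ‖γ‖ ≤ max (L + 1) (ρ + ρ) := by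
    intro γ hγ y hy hyγ h
    refine ⟨hγ, norm_prod_le_iff.2 ⟨h.trans (le_max_left _ _), le_trans ?_ (le_max_right _ _)⟩⟩
    have := norm_sub_le (y + γ.2) y
    rw [add_sub_cancel_left] at this
    linarith
  have : Finite {γ : ℝ × EuclideanSpace ℝ (Fin d) | γ ∈ Γ ∧ ‖γ‖ ≤ max (L + 1) (ρ + ρ)} := hfin
  -- The condition for `z - p₂(v)` to have partner `z`, read off at `z`.
  have hback : ∀ v ∈ Γ, ∀ z, z - v.2 ∈ partnerPiece Γ W W' M B v →
      -v.1 ∈ pattern Γ W z ∧ ∃ s t, disc Γ W W' z t - disc Γ W W' z s = M ∧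
        signedCount (pattern Γ W z) (-v.1) = disc Γ W W' z t := by
    rintro v hv z ⟨h1, h2, b, hb, h3, h4⟩
    have hv' := Γ.neg_mem hv
    have hz : z - v.2 = z + (-v).2 := by rw [Prod.snd_neg, sub_eq_add_neg]
    rw [hz] at h1 h3 h4
    refine ⟨(fst_mem_pattern hΓ.1 hv').2 h1, b.1 + (-v).1, b.2 + (-v).1, ?_, ?_⟩
    · rw [disc_add hW hW' hv', disc_add hW hW' hv'] at h3
      omega
    · rw [disc_add hW hW' hv', signedCount_pattern_add hW' hv'] at h4
      simp only [Prod.fst_neg, add_neg_cancel, signedCount_zero] at h4 ⊢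
      have : disc Γ W W' z (-v.1) =
        signedCount (pattern Γ W z) (-v.1) - signedCount (pattern Γ W' z) (-v.1) := rfl
      omega
  refine equidecomposableUpToNull_of_finite
    (ι := {γ : ℝ × EuclideanSpace ℝ (Fin d) | γ ∈ Γ ∧ ‖γ‖ ≤ max (L + 1) (ρ + ρ)})
    (fun v => partnerPiece Γ W W' M B v.1) (fun v => v.1.2) (genericSet Γ W W')
    (fun v => finitelyDetermined_partnerPiece hW hW' M B v.1)
    (fun v => ⟨v.1, v.2.1, rfl⟩) (volume_compl_genericSet hfW hfW') ?_ ?_ ?_ ?_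
  · rintro y hy ⟨v, hv⟩ ⟨w, hw⟩ ⟨-, h1, b, -, h2, h3⟩ ⟨-, h4, c, -, h5, h6⟩
    dsimp only at h1 h3 h4 h6
    have h7 := disc_eq_of_max (hM y hy) h2 h5
    have h8 := signedCount_injOn (hA' y) ((fst_mem_pattern hΓ.1 hv.1).2 h1)
      ((fst_mem_pattern hΓ.1 hw.1).2 h4) (by omega)
    exact Subtype.ext (hΓ.1 hv.1 hw.1 h8)
  · refine fun y hy => ⟨fun ⟨v, hv⟩ => hv.1, fun hyW => ?_⟩
    obtain ⟨s₁, t₁, s₂, t₂, h1, h2, h3, h4, h5, h6⟩ := hpeaks y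
    obtain ⟨b, hb, h7⟩ := hB y (hρ y (Or.inl hyW))
    have e1 := disc_eq_of_max (hM y hy) h7 h1
    have e2 := disc_eq_of_max (hM y hy) h7 h2
    have h0 : (0 : ℝ) ∈ pattern Γ W y := ⟨0, Γ.zero_mem, by simpa using hyW, rfl⟩
    have l1 := signedCount_mono (hA y) h4
    have l2 := signedCount_lt (hA y) h0 h5
    rw [signedCount_zero] at l1 l2
    obtain ⟨_, ⟨v, hv, hvW, rfl⟩, h8, h9⟩ :=
      exists_signedCount_eq (hA' y) (b₁ := t₁) (b₂ := t₂) (k := -disc Γ W W' y b.2)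
        (by rw [e1]; unfold disc; omega) (by rw [e2]; unfold disc; omega)
    exact ⟨⟨v, hmemF v hv y (hρ y (Or.inl hyW)) (hρ _ (Or.inr hvW))
      (abs_le.2 ⟨by linarith [h8.1], by linarith [h8.2]⟩)⟩, hyW, hvW, b, hb, h7, by
        dsimp only; omega⟩
  · rintro z hz ⟨v, hv⟩ ⟨w, hw⟩ h1 h2
    obtain ⟨h3, s, t, h4, h5⟩ := hback v hv.1 z h1
    obtain ⟨h6, s', t', h7, h8⟩ := hback w hw.1 z h2
    have h9 := disc_eq_of_max (hM z hz) h4 h7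
    have h10 := signedCount_injOn (hA z) h3 h6 (by omega)
    exact Subtype.ext (hΓ.1 hv.1 hw.1 (neg_injective h10))
  · refine fun z hz => ⟨fun ⟨v, hv⟩ => by simpa using hv.2.1, fun hzW => ?_⟩
    obtain ⟨s₁, t₁, s₂, t₂, h1, h2, h3, h4, h5, h6⟩ := hpeaks z
    have e := disc_eq_of_max (hM z hz) h1 h2
    have h0 : (0 : ℝ) ∈ pattern Γ W' z := ⟨0, Γ.zero_mem, by simpa using hzW, rfl⟩
    have l1 := signedCount_mono (hA' z) h4
    have l2 := signedCount_lt (hA' z) h0 h5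
    rw [signedCount_zero] at l1 l2
    obtain ⟨_, ⟨w, hw, hwW, rfl⟩, h8, h9⟩ :=
      exists_signedCount_eq (hA z) (b₁ := t₁) (b₂ := t₂) (k := disc Γ W W' z t₁)
        (by unfold disc; omega) (by rw [e]; unfold disc; omega)
    have hwn := hρ _ (Or.inl hwW)
    obtain ⟨b, hb, h7⟩ := hB (z + w.2) hwn
    refine ⟨⟨-w, hmemF (-w) (Γ.neg_mem hw) (z + w.2) hwn ?_ ?_⟩, ?_, ?_, b, hb, ?_, ?_⟩
    · simpa using hρ z (Or.inr hzW)
    · rw [Prod.fst_neg, abs_neg]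
      exact abs_le.2 ⟨by linarith [h8.1], by linarith [h8.2]⟩
    · simpa using hwW
    · simpa using hzW
    · simpa using h7
    · have h10 : disc Γ W W' z (b.2 + w.1) = disc Γ W W' z t₁ := by
        refine disc_eq_of_max (hM z hz) (s := b.1 + w.1) ?_ h1
        rw [disc_add hW hW' hw, disc_add hW hW' hw] at h7
        omega
      have h11 : disc Γ W W' z w.1 =
        signedCount (pattern Γ W z) w.1 - signedCount (pattern Γ W' z) w.1 := rfl
      simp only [Prod.snd_neg, Prod.fst_neg, sub_neg_eq_add]
      rw [disc_add hW hW' hw, signedCount_pattern_add hW' hw, neg_add_cancel, signedCount_zero]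
      omega

lemma FinitelyDetermined.isRiemannMeasurable {S : Set (EuclideanSpace ℝ (Fin d))}
    (hS : FinitelyDetermined W W' S) (hW : IsRiemannMeasurable W)
    (hW' : IsRiemannMeasurable W') : IsRiemannMeasurable S := by
  obtain ⟨hSW, T, hT⟩ := hS
  have hsub : frontier S ⊆ frontier W ∪
      ⋃ t ∈ (T : Set (EuclideanSpace ℝ (Fin d))), (· + t) ⁻¹' (frontier W ∪ frontier W') := by
    intro x hx
    by_contra hcon
    simp only [mem_union, mem_iUnion, mem_preimage, not_or, not_exists] at hcon
    obtain ⟨h1, h2⟩ := hcon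
    have e1 := eventually_mem_iff_of_notMem_frontier h1
    have e2 : ∀ᶠ y in nhds x, ∀ t ∈ T, (y + t ∈ W ↔ x + t ∈ W) ∧ (y + t ∈ W' ↔ x + t ∈ W') := by
      refine (Filter.eventually_all_finset T).2 fun t ht => ?_
      have hc : ContinuousAt (· + t) x := by fun_prop
      exact (hc.eventually (eventually_mem_iff_of_notMem_frontier (h2 t ht).1)).and
        (hc.eventually (eventually_mem_iff_of_notMem_frontier (h2 t ht).2))
    have e3 : ∀ᶠ y in nhds x, (y ∈ S ↔ x ∈ S) := by
      filter_upwards [e1, e2] with y hy1 hy2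
      refine ⟨fun h => hT y (hSW h) x (hy1.1 (hSW h)) hy2 h, fun h =>
        hT x (hSW h) y (hy1.2 (hSW h)) (fun t ht => ⟨(hy2 t ht).1.symm, (hy2 t ht).2.symm⟩) h⟩
    by_cases h : x ∈ S
    · exact hx.2 (mem_interior_iff_mem_nhds.2 (e3.mono fun y hy => hy.2 h))
    · obtain ⟨y, hy, hy'⟩ := ((mem_closure_iff_frequently.1 hx.1).and_eventually e3).exists
      exact h (hy'.1 hy)
  refine measure_mono_null hsub (measure_union_null hW
    ((measure_biUnion_null_iff T.countable_toSet).2 fun t _ => ?_))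
  rw [measure_preimage_add_right]
  exact measure_union_null hW hW'

/-- Pieces may be changed on null sets: these and their translates are removed from the set of
full measure on which the decomposition is exact. -/
lemma EquidecomposableUpToNull.congr_ae {G : AddSubgroup (EuclideanSpace ℝ (Fin d))}
    {P Q : Set (EuclideanSpace ℝ (Fin d)) → Prop} (h : EquidecomposableUpToNull G P W W')
    (hPQ : ∀ S, P S → ∃ S', Q S' ∧ ∃ N, volume N = 0 ∧ ∀ x ∉ N, (x ∈ S' ↔ x ∈ S)) :
    EquidecomposableUpToNull G Q W W' := by
  obtain ⟨n, S, g, X, hP, hg, hX, hd, hu, hd', hu'⟩ := h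
  choose S' hQ N hN hS' using fun j => hPQ (S j) (hP j)
  refine equidecomposableUpToNull_of_finite S' g
    (X \ ⋃ j, (N j ∪ (· - g j) ⁻¹' N j)) hQ hg ?_ ?_ ?_ ?_ ?_
  · rw [sdiff_eq, compl_inter, compl_compl]
    refine measure_union_null hX (measure_iUnion_null fun j => measure_union_null (hN j) ?_)
    simp only [sub_eq_add_neg]
    rw [measure_preimage_add_right, hN]
  all_goals
    rintro x ⟨hxX, hxN⟩
    simp only [mem_iUnion, mem_union, mem_preimage, not_exists, not_or] at hxN
    have hS₁ := fun j => hS' j x (hxN j).1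
    have hS₂ := fun j => hS' j (x - g j) (hxN j).2
  · intro i j hi hj
    by_contra hij
    exact disjoint_left.1 (hd hij) ⟨(hS₁ i).1 hi, hxX⟩ ⟨(hS₁ j).1 hj, hxX⟩
  · have := Set.ext_iff.1 hu x
    simp only [mem_iUnion, mem_inter_iff, hxX, and_true] at this
    simp only [hS₁, this]
  · intro i j hi hj
    by_contra hij
    exact disjoint_left.1 (hd' hij) ⟨mem_image_add_right_iff.2 ((hS₂ i).1 hi), hxX⟩
      ⟨mem_image_add_right_iff.2 ((hS₂ j).1 hj), hxX⟩
  · have := Set.ext_iff.1 hu' x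
    simp only [mem_iUnion, mem_inter_iff, hxX, and_true, mem_image_add_right_iff] at this
    simp only [hS₂, this]

end Decomposition

/-! ### Subdividing simplices by hyperplanes -/

section Tiling

/-- Moving the vertex `b i` along the edge towards `b j`, to a point other than `b j`, gives an
affine basis, with the stated change of barycentric coordinates. -/
lemma AffineBasis.exists_update {ι V : Type*} [Fintype ι] [DecidableEq ι] [NormedAddCommGroup V]
    [NormedSpace ℝ V] [FiniteDimensional ℝ V] (b : AffineBasis ι ℝ V) {i j : ι} (hij : i ≠ j)
    {s : ℝ} (hs : s ≠ 1) :
    ∃ b' : AffineBasis ι ℝ V,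
      (∀ k, b' k = if k = i then AffineMap.lineMap (b i) (b j) s else b k) ∧
      ∀ k x, b.coord k x = b'.coord k x +
        s * b'.coord i x * ((if k = j then 1 else 0) - if k = i then 1 else 0) := by
  set c := AffineMap.lineMap (b i) (b j) s with hc
  have hcoord : ∀ k, b.coord k c = (1 - s) * (if k = i then 1 else 0)
      + s * (if k = j then 1 else 0) := by
    intro k
    rw [hc, AffineMap.apply_lineMap, b.coord_apply, b.coord_apply, AffineMap.lineMap_apply_ring]
  have hspan : c ∉ affineSpan ℝ (b '' {k | k ≠ i}) := by
    intro h
    have hle : affineSpan ℝ (b '' {k | k ≠ i}) ≤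
        AffineSubspace.comap (b.coord i) (AffineSubspace.mk' 0 ⊥) := by
      rw [affineSpan_le]
      rintro _ ⟨k, hk, rfl⟩
      simp [b.coord_apply_ne (Ne.symm hk), AffineSubspace.mem_mk']
    have h' := hle h
    simp only [AffineSubspace.mem_comap, AffineSubspace.mem_mk', hcoord, if_true, hij, if_false,
      vsub_eq_sub, sub_zero, Submodule.mem_bot, mul_one, mul_zero, add_zero] at h'
    exact hs (by linarith)
  have hind := b.ind.affineIndependent_update_of_notMem_affineSpan (i := i) hspan
  have htop : affineSpan ℝ (range (Function.update b i c)) = ⊤ := by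
    rw [hind.affineSpan_eq_top_iff_card_eq_finrank_add_one]
    exact b.ind.affineSpan_eq_top_iff_card_eq_finrank_add_one.1 b.tot
  let b' : AffineBasis ι ℝ V := ⟨Function.update b i c, hind, htop⟩
  have hb' : ∀ k, b' k = if k = i then c else b k := fun k => Function.update_apply _ _ _ _
  refine ⟨b', hb', fun k x => ?_⟩
  have h1 : b.coord k x = ∑ m, b'.coord m x * b.coord k (b' m) :=
    (congrFun (b.toMatrix_vecMul_coords b' x) k).symm
  have h2 : ∀ m, b.coord k (b' m) = (if k = m then 1 else 0) +
      if m = i then s * ((if k = j then 1 else 0) - if k = i then 1 else 0) else 0 := by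
    intro m
    rw [hb']
    by_cases hm : m = i
    · subst hm
      simp only [if_true, hcoord]; ring
    · simp [hm, b.coord_apply]
  rw [h1]
  simp only [h2, mul_add, Finset.sum_add_distrib, mul_ite, mul_zero, mul_one,
    Finset.sum_ite_eq, Finset.sum_ite_eq', Finset.mem_univ, if_true]
  ring

variable {d : ℕ}

/-- `A` is a finite union of simplices with pairwise disjoint interiors, each with the property
`Q`. Simplices are encoded by affine bases, the families of their vertices. -/
def Tileable (Q : AffineBasis (Fin (d + 1)) ℝ (EuclideanSpace ℝ (Fin d)) → Prop)
    (A : Set (EuclideanSpace ℝ (Fin d))) : Prop :=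
  ∃ (ι : Type) (_ : Finite ι) (τ : ι → AffineBasis (Fin (d + 1)) ℝ (EuclideanSpace ℝ (Fin d))),
    (∀ i, Q (τ i)) ∧
    Pairwise (fun i j => Disjoint (interior (convexHull ℝ (range (τ i))))
      (interior (convexHull ℝ (range (τ j))))) ∧
    A = ⋃ i, convexHull ℝ (range (τ i))

variable {Q Q' : AffineBasis (Fin (d + 1)) ℝ (EuclideanSpace ℝ (Fin d)) → Prop}
  {A : Set (EuclideanSpace ℝ (Fin d))}

lemma tileable_convexHull {b : AffineBasis (Fin (d + 1)) ℝ (EuclideanSpace ℝ (Fin d))}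
    (hb : Q b) : Tileable Q (convexHull ℝ (range b)) :=
  ⟨Unit, inferInstance, fun _ => b, fun _ => hb, fun _ _ h => absurd rfl h, (iUnion_const _).symm⟩

/-- Tilings of the tiles combine to a tiling of the whole. The new tiles may be assumed to lie in
the old ones, so that properties inherited by subsets are kept. -/
lemma Tileable.refine (hA : Tileable Q A)
    (h : ∀ b, Q b → Tileable
      (fun b' => convexHull ℝ (range b') ⊆ convexHull ℝ (range b) → Q' b')
      (convexHull ℝ (range b))) :
    Tileable Q' A := by
  obtain ⟨ι, _, τ, hQ, hd, rfl⟩ := hA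
  choose κ hκ σ hQ' hd' hu using fun i => h (τ i) (hQ i)
  have hsub : ∀ i k, convexHull ℝ (range (σ i k)) ⊆ convexHull ℝ (range (τ i)) := fun i k => by
    rw [hu i]; exact subset_iUnion_of_subset k subset_rfl
  refine ⟨Σ i, κ i, inferInstance, fun p => σ p.1 p.2, fun p => hQ' _ _ (hsub _ _), ?_, ?_⟩
  · rintro ⟨i, k⟩ ⟨j, l⟩ hne
    by_cases hij : i = j
    · subst hij
      exact hd' i fun hkl => hne (congrArg (Sigma.mk i) hkl)
    · exact (hd hij).mono (interior_mono (hsub _ _)) (interior_mono (hsub _ _))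
  · rw [iUnion_sigma]
    exact iUnion_congr hu

lemma tileable_iff_isPolytope : Tileable (fun _ => True) A ↔ IsPolytope A := by
  constructor
  · rintro ⟨ι, _, τ, -, hd, rfl⟩
    obtain ⟨n, ⟨e⟩⟩ := Finite.exists_equiv_fin ι
    refine ⟨n, fun i => ⟨τ (e.symm i), (τ (e.symm i)).ind⟩,
      fun i j hij => hd (e.symm.injective.ne hij), ?_⟩
    exact (e.symm.surjective.iUnion_comp fun i => convexHull ℝ (range (τ i))).symm
  · rintro ⟨n, σ, hd, rfl⟩
    exact ⟨Fin n, inferInstance, fun i => ⟨(σ i).points, (σ i).independent, by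
      rw [(σ i).independent.affineSpan_eq_top_iff_card_eq_finrank_add_one]; simp⟩,
      fun _ => trivial, hd, rfl⟩

/-- The function `f` has constant sign, in the weak sense, on `A`. -/
def HasConstantSign (f : EuclideanSpace ℝ (Fin d) →ᵃ[ℝ] ℝ) (A : Set (EuclideanSpace ℝ (Fin d))) :
    Prop :=
  (∀ x ∈ A, 0 ≤ f x) ∨ ∀ x ∈ A, f x ≤ 0

/-- A point in the relative interior of an edge divides the simplex into the two simplices obtained
by moving one or the other end of the edge to that point. -/
lemma tileable_convexHull_of_edge (b : AffineBasis (Fin (d + 1)) ℝ (EuclideanSpace ℝ (Fin d)))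
    {i j : Fin (d + 1)} (hij : i ≠ j) {s : ℝ} (hs0 : 0 < s) (hs1 : s < 1) :
    Tileable (fun b' => ∃ m, (m = i ∨ m = j) ∧
      ∀ k, b' k = if k = m then AffineMap.lineMap (b i) (b j) s else b k)
      (convexHull ℝ (range b)) := by
  obtain ⟨b₁, hb₁, hc₁⟩ := b.exists_update hij hs1.ne
  obtain ⟨b₂, hb₂, hc₂⟩ := b.exists_update hij.symm (s := 1 - s) (by linarith)
  rw [AffineMap.lineMap_apply_one_sub] at hb₂
  have i₁ : ∀ x, b.coord i x = (1 - s) * b₁.coord i x := fun x => by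
    rw [hc₁]; simp [hij]; ring
  have j₁ : ∀ x, b.coord j x = b₁.coord j x + s * b₁.coord i x := fun x => by
    rw [hc₁]; simp [hij.symm]
  have i₂ : ∀ x, b.coord i x = b₂.coord i x + (1 - s) * b₂.coord j x := fun x => by
    rw [hc₂]; simp [hij]
  have j₂ : ∀ x, b.coord j x = s * b₂.coord j x := fun x => by
    rw [hc₂]; simp [hij.symm]; ring
  have k₁ : ∀ k, k ≠ i → k ≠ j → ∀ x, b.coord k x = b₁.coord k x := fun k hi hj x => by
    rw [hc₁]; simp [hi, hj]
  have k₂ : ∀ k, k ≠ i → k ≠ j → ∀ x, b.coord k x = b₂.coord k x := fun k hi hj x => by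
    rw [hc₂]; simp [hi, hj]
  have hs : 0 < 1 - s := by linarith
  -- The common facet of the two parts lies in the hyperplane where this expression vanishes.
  have side₁ : ∀ x, (1 - s) * b.coord j x - s * b.coord i x = (1 - s) * b₁.coord j x := fun x => by
    rw [i₁, j₁]; ring
  have side₂ : ∀ x, (1 - s) * b.coord j x - s * b.coord i x = -(s * b₂.coord i x) := fun x => by
    rw [i₂, j₂]; ring
  have hdisj : Disjoint (interior (convexHull ℝ (range b₁)))
      (interior (convexHull ℝ (range b₂))) := by
    rw [b₁.interior_convexHull, b₂.interior_convexHull]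
    refine disjoint_left.2 fun x h1 h2 => ?_
    have e1 := mul_pos hs (h1 j)
    have e2 := mul_pos hs0 (h2 i)
    have := side₁ x
    have := side₂ x
    linarith
  refine ⟨Bool, inferInstance, fun t => if t then b₁ else b₂, ?_, ?_, ?_⟩
  · rintro (_ | _)
    · exact ⟨j, Or.inr rfl, by simpa using hb₂⟩
    · exact ⟨i, Or.inl rfl, by simpa using hb₁⟩
  · rintro (_ | _) (_ | _) h
    · exact absurd rfl h
    · simpa using hdisj.symm
    · simpa using hdisj
    · exact absurd rfl h
  · ext x
    rw [mem_iUnion, Bool.exists_bool, or_comm]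
    simp only [if_true, Bool.false_eq_true, if_false, AffineBasis.convexHull_eq_nonneg_coord,
      mem_ofPred_eq]
    constructor
    · intro h
      rcases le_total 0 ((1 - s) * b.coord j x - s * b.coord i x) with h0 | h0
      · left
        intro k
        by_cases hki : k = i
        · subst hki
          exact nonneg_of_mul_nonneg_right (i₁ x ▸ h k) hs
        by_cases hkj : k = j
        · subst hkj
          exact nonneg_of_mul_nonneg_right (side₁ x ▸ h0) hs
        · exact k₁ k hki hkj x ▸ h k
      · right
        intro k
        by_cases hki : k = i
        · subst hki
          rw [side₂] at h0
          exact nonneg_of_mul_nonneg_right (by linarith) hs0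
        by_cases hkj : k = j
        · subst hkj
          exact nonneg_of_mul_nonneg_right (j₂ x ▸ h k) hs0
        · exact k₂ k hki hkj x ▸ h k
    · rintro (h | h) k
      · by_cases hki : k = i
        · subst hki
          rw [i₁]; exact mul_nonneg hs.le (h _)
        by_cases hkj : k = j
        · subst hkj
          rw [j₁]; exact add_nonneg (h _) (mul_nonneg hs0.le (h _))
        · rw [k₁ k hki hkj]; exact h k
      · by_cases hki : k = i
        · subst hki
          rw [i₂]; exact add_nonneg (h _) (mul_nonneg hs.le (h _))
        by_cases hkj : k = j
        · subst hkj
          rw [j₂]; exact mul_nonneg hs0.le (h _)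
        · rw [k₂ k hki hkj]; exact h k

/-- Cutting an edge at its crossing with the hyperplane `f = 0` trades a vertex off the hyperplane
for one on it, so repeated cutting ends with simplices that the hyperplane does not cross. -/
lemma tileable_hasConstantSign (f : EuclideanSpace ℝ (Fin d) →ᵃ[ℝ] ℝ)
    (b : AffineBasis (Fin (d + 1)) ℝ (EuclideanSpace ℝ (Fin d))) :
    Tileable (fun b' => HasConstantSign f (convexHull ℝ (range b'))) (convexHull ℝ (range b)) := by
  induction hn : (Finset.univ.filter fun k => f (b k) ≠ 0).card using Nat.strong_induction_on
    generalizing b with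
  | _ n ih =>
  by_cases h0 : ∀ k, 0 ≤ f (b k)
  · refine tileable_convexHull (Or.inl ?_)
    exact convexHull_min (range_subset_iff.2 h0) ((convex_Ici 0).affine_preimage f)
  by_cases h1 : ∀ k, f (b k) ≤ 0
  · refine tileable_convexHull (Or.inr ?_)
    exact convexHull_min (range_subset_iff.2 h1) ((convex_Iic 0).affine_preimage f)
  push Not at h0 h1
  obtain ⟨i, hi⟩ := h0
  obtain ⟨j, hj⟩ := h1
  have hij : i ≠ j := by rintro rfl; linarith
  have hpos : 0 < f (b j) - f (b i) := by linarith
  have hc : f (AffineMap.lineMap (b i) (b j) (-f (b i) / (f (b j) - f (b i)))) = 0 := by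
    rw [AffineMap.apply_lineMap, AffineMap.lineMap_apply_ring]
    field_simp
    ring
  refine (tileable_convexHull_of_edge b hij (s := -f (b i) / (f (b j) - f (b i)))
    (div_pos (by linarith) hpos) ((div_lt_one hpos).2 (by linarith))).refine ?_
  rintro b' ⟨m, hm, hb'⟩
  have hfm : f (b m) ≠ 0 := by
    rcases hm with rfl | rfl
    · exact hi.ne
    · exact hj.ne'
  obtain ⟨ι, hι, τ, hQ, hd, hu⟩ := ih _ (by
    rw [← hn]
    refine Finset.card_lt_card ((Finset.ssubset_iff_of_subset fun k hk => ?_).2 ⟨m, ?_, ?_⟩)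
    · simp only [Finset.mem_filter, Finset.mem_univ, true_and, hb'] at hk ⊢
      split_ifs at hk with hkm
      · exact absurd hc hk
      · exact hk
    · simpa using hfm
    · simp [hb', hc]) b' rfl
  exact ⟨ι, hι, τ, fun i _ => hQ i, hd, hu⟩

lemma Tileable.hasConstantSign (hA : Tileable (fun _ => True) A)
    {Φ : Set (EuclideanSpace ℝ (Fin d) →ᵃ[ℝ] ℝ)} (hΦ : Φ.Finite) :
    Tileable (fun b => ∀ f ∈ Φ, HasConstantSign f (convexHull ℝ (range b))) A := by
  induction Φ, hΦ using Set.Finite.induction_on with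
  | empty => simpa using hA
  | @insert f Φ _ _ ih =>
    refine ih.refine fun b hb => ?_
    obtain ⟨ι, hι, τ, hQ, hd, hu⟩ := tileable_hasConstantSign f b
    refine ⟨ι, hι, τ, fun i hi g hg => ?_, hd, hu⟩
    rcases hg with rfl | hg
    · exact hQ i
    · exact (hb g hg).imp (fun h x hx => h x (hi hx)) fun h x hx => h x (hi hx)

lemma volume_affineMap_eq_zero {f : EuclideanSpace ℝ (Fin d) →ᵃ[ℝ] ℝ}
    {p : EuclideanSpace ℝ (Fin d)} (hp : f p ≠ 0) : volume {x | f x = 0} = 0 := by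
  have h := Measure.addHaar_affineSubspace (volume : Measure (EuclideanSpace ℝ (Fin d)))
    (AffineSubspace.comap f (AffineSubspace.mk' 0 ⊥)) (fun htop => hp (by
      have : p ∈ AffineSubspace.comap f (AffineSubspace.mk' 0 ⊥) := by rw [htop]; trivial
      simpa [AffineSubspace.mem_mk'] using this))
  refine measure_mono_null (fun x hx => ?_) h
  simpa [AffineSubspace.mem_mk'] using hx

lemma IsPolytope.isBounded (hA : IsPolytope A) : Bornology.IsBounded A := by
  obtain ⟨n, σ, -, rfl⟩ := hA
  exact Bornology.isBounded_iUnion.2 fun i => isBounded_convexHull.2 (finite_range _).isBounded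

lemma IsPolytope.isRiemannMeasurable (hA : IsPolytope A) : IsRiemannMeasurable A := by
  obtain ⟨n, σ, -, rfl⟩ := hA
  refine measure_mono_null ?_ (measure_iUnion_null fun i : Fin n =>
    (convex_convexHull ℝ (range (σ i).points)).addHaar_frontier volume)
  intro x hx
  by_contra h
  simp only [mem_iUnion, not_exists] at h
  have hev := Filter.eventually_all.2 fun i => eventually_mem_iff_of_notMem_frontier (h i)
  have hev' := hev.mono fun y hy => show _ ↔ _ from
    (mem_iUnion.trans (exists_congr hy)).trans mem_iUnion.symm
  by_cases hxA : x ∈ ⋃ i, convexHull ℝ (range (σ i).points)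
  · exact hx.2 (mem_interior_iff_mem_nhds.2 (hev'.mono fun y hy => hy.2 hxA))
  · obtain ⟨y, hy, hy'⟩ := ((mem_closure_iff_frequently.1 hx.1).and_eventually hev').exists
    exact hxA (hy'.1 hy)

/-- The simplices of `W` are subdivided until the barycentric coordinates of all simplices of `W`
and `W'`, evaluated at the relevant translates, have constant sign on each tile. Off the zeros of
these functions, `S` then contains all or nothing of a tile. -/
lemma FinitelyDetermined.exists_isPolytope {W W' S : Set (EuclideanSpace ℝ (Fin d))}
    (hS : FinitelyDetermined W W' S) (hW : IsPolytope W) (hW' : IsPolytope W') :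
    ∃ S', IsPolytope S' ∧ ∃ N, volume N = 0 ∧ ∀ x ∉ N, (x ∈ S' ↔ x ∈ S) := by
  obtain ⟨hSW, T, hT⟩ := hS
  have htile := tileable_iff_isPolytope.2 hW
  obtain ⟨ι, _, σ, -, -, hσ⟩ := tileable_iff_isPolytope.2 hW
  obtain ⟨ι', _, σ', -, -, hσ'⟩ := tileable_iff_isPolytope.2 hW'
  let Ψ : T × (ι ⊕ ι') × Fin (d + 1) → EuclideanSpace ℝ (Fin d) →ᵃ[ℝ] ℝ := fun p =>
    ((Sum.elim σ σ' p.2.1).coord p.2.2).comp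
      (AffineMap.id ℝ _ + AffineMap.const ℝ _ (p.1 : EuclideanSpace ℝ (Fin d)))
  have hΨ : ∀ p x, Ψ p x = (Sum.elim σ σ' p.2.1).coord p.2.2 (x + p.1) := fun p x => rfl
  obtain ⟨κ, _, τ, hsign, hd, hWτ⟩ := htile.hasConstantSign (finite_range Ψ)
  let N : Set (EuclideanSpace ℝ (Fin d)) := ⋃ p, {x | Ψ p x = 0}
  have hN : volume N = 0 := by
    refine measure_iUnion_null fun p => volume_affineMap_eq_zero
      (p := Sum.elim σ σ' p.2.1 p.2.2 - p.1) ?_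
    rw [hΨ, sub_add_cancel, AffineBasis.coord_apply_eq]
    exact one_ne_zero
  -- Off `N`, the points of a tile agree in every membership that decides `S`.
  have hconst : ∀ k, ∀ x ∈ convexHull ℝ (range (τ k)), x ∉ N → ∀ y ∈ convexHull ℝ (range (τ k)),
      y ∉ N → x ∈ S → y ∈ S := by
    intro k x hx hxN y hy hyN
    have hp : ∀ p, 0 ≤ Ψ p x ↔ 0 ≤ Ψ p y := by
      intro p
      have hx0 : Ψ p x ≠ 0 := fun h => hxN (mem_iUnion.2 ⟨p, h⟩)
      have hy0 : Ψ p y ≠ 0 := fun h => hyN (mem_iUnion.2 ⟨p, h⟩)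
      rcases hsign k _ (mem_range_self p) with h | h
      · exact iff_of_true (h x hx) (h y hy)
      · exact iff_of_false (fun h' => hx0 (le_antisymm (h x hx) h'))
          fun h' => hy0 (le_antisymm (h y hy) h')
    have hmem : ∀ z, (∃ k, z ∈ convexHull ℝ (range (τ k))) ↔ z ∈ W := fun z => by
      rw [hWτ, mem_iUnion]
    refine hT x ((hmem x).1 ⟨k, hx⟩) y ((hmem y).1 ⟨k, hy⟩) fun t ht => ⟨?_, ?_⟩
    · rw [hσ]
      simp only [AffineBasis.convexHull_eq_nonneg_coord, mem_iUnion, mem_ofPred_eq]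
      exact exists_congr fun i => forall_congr' fun m => hp ⟨⟨t, ht⟩, Sum.inl i, m⟩
    · rw [hσ']
      simp only [AffineBasis.convexHull_eq_nonneg_coord, mem_iUnion, mem_ofPred_eq]
      exact exists_congr fun i => forall_congr' fun m => hp ⟨⟨t, ht⟩, Sum.inr i, m⟩
  refine ⟨⋃ k : {k // ∃ x ∈ convexHull ℝ (range (τ k)), x ∉ N ∧ x ∈ S},
    convexHull ℝ (range (τ k)), tileable_iff_isPolytope.1 ⟨_, inferInstance, fun k => τ k.1,
      fun _ => trivial, fun i j hij => hd (Subtype.coe_injective.ne hij), rfl⟩, N, hN,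
    fun y hyN => ⟨fun hy => ?_, fun hy => ?_⟩⟩
  · obtain ⟨⟨k, x, hx, hxN, hxS⟩, hy⟩ := mem_iUnion.1 hy
    exact hconst k x hx hxN y hy hyN hxS
  · have hyW := hSW hy
    rw [hWτ] at hyW
    obtain ⟨k, hk⟩ := mem_iUnion.1 hyW
    exact mem_iUnion.2 ⟨⟨k, y, hk, hyN, hy⟩, hk⟩

end Tiling

/-! ### Equidecomposability of the windows -/

theorem mainTheorem3 (d : ℕ) (Γ : Submodule ℤ (ℝ × EuclideanSpace ℝ (Fin d)))
    [DiscreteTopology Γ] [IsZLattice ℝ Γ] (hΓ : InGeneralPosition Γ)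
    (W W' : Set (EuclideanSpace ℝ (Fin d)))
    (hbd : BoundedDistanceEquivalent (modelSet Γ W) (modelSet Γ W')) :
    ((Bornology.IsBounded W ∧ IsRiemannMeasurable W) →
      (Bornology.IsBounded W' ∧ IsRiemannMeasurable W') →
        EquidecomposableUpToNull (sndProj Γ)
          (fun S => Bornology.IsBounded S ∧ IsRiemannMeasurable S) W W') ∧
    (IsPolytope W → IsPolytope W' →
      EquidecomposableUpToNull (sndProj Γ) IsPolytope W W') := by
  refine ⟨fun hW hW' => ?_, fun hW hW' => ?_⟩
  · exact (equidecomposable_finitelyDetermined hΓ hW.1 hW'.1 hW.2 hW'.2 hbd).congr_ae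
      fun S hS => ⟨S, ⟨hW.1.subset hS.1, hS.isRiemannMeasurable hW.2 hW'.2⟩, ∅, measure_empty,
        fun _ _ => Iff.rfl⟩
  · exact (equidecomposable_finitelyDetermined hΓ hW.isBounded hW'.isBounded
      hW.isRiemannMeasurable hW'.isRiemannMeasurable hbd).congr_ae
      fun S hS => hS.exists_isPolytope hW hW'
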